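/- Let $d,m\in\mathbb N$, let $Z$ be an integrable real random variable, $X$ a random vector in $\mathbb R^m$, and $H:\mathbb R^d\times\mathbb R^m\to\mathbb R$ a measurable function such that, for every $\theta\in\mathbb R^d$, $\mathbb E|H(\theta,X)|<\infty$, $\mathbb E(H(\theta,X))=\mathbb E(Z)$, and the variance $v(\theta)=\operatorname{Var}(H(\theta,X))$ is finite. Let $(X_n)_{n\ge1}$ be an i.i.d. sequence of random vectors with the law of $X$, and let $\mathcal F_n=\sigma(X_1,\dots,X_n)$ for $n\ge 0$ (so that $\mathcal F_0$ is trivial). Let $(\theta_n)_{n\ge0}$ be an $(\mathcal F_n)$-adapted sequence with values in $\mathbb R^d$ that converges almost surely to a deterministic $\theta_\infty\in\mathbb R^d$, and put $$\xi_n=\frac1n\sum_{i=1}^n H(\theta_{i-1},X_i),\qquad n\ge1 .$$ Suppose that for some $\eta>0$ the function $\theta\mapsto\mathbb E\left(|H(\theta,X)|^{2+\eta}\right)$ is finite on all of $\mathbb R^d$ and continuous at $\theta_\infty$, and that $v$ is continuous at $\theta_\infty$ with $v(\theta_\infty)>0$. Then $$\sqrt n\,\bigl(\xi_n-\mathbb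 E(Z)\bigr)\ \longrightarrow\ \mathcal N\bigl(0,v(\theta_\infty)\bigr)\quad\text{in law as } n\to\infty .$$ -/

import Mathlib

open MeasureTheory ProbabilityTheory Filter Topology

namespace AdaptiveIS

/-- The σ-algebras `ℱ n = σ(X 1, …, X n)` generated by a sequence `(X n)_{n ≥ 1}` of random
vectors; in particular `ℱ 0` is trivial. The sequence starts at index `1`: the value `X 0` is
never used. -/
def sampleFiltration {Ω E : Type*} [mΩ : MeasurableSpace Ω] [MeasurableSpace E]
    (X : ℕ → Ω → E) (hX : ∀ n, 1 ≤ n → Measurable (X n)) : Filtration ℕ mΩ where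
  seq n := ⨆ i ∈ Finset.Icc 1 n, MeasurableSpace.comap (X i) inferInstance
  mono' _ _ hnk := biSup_mono fun _ hi => Finset.Icc_subset_Icc_right hnk hi
  le' _ := iSup₂_le fun i hi => (hX i (Finset.mem_Icc.mp hi).1).comap_le

/-- `𝔼 Z = 𝔼 H(θ, X)` for all `θ ∈ ℝᵈ`, where `H : ℝᵈ × ℝᵐ → ℝ` is measurable, all
expectations exist, and `H(θ, X)` has finite variance for all `θ`. -/
structure IsParametricRepresentation {d m : ℕ} {Ω : Type*} [MeasurableSpace Ω] (P : Measure Ω)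
    (Z : Ω → ℝ) (X : Ω → EuclideanSpace ℝ (Fin m))
    (H : EuclideanSpace ℝ (Fin d) → EuclideanSpace ℝ (Fin m) → ℝ) : Prop where
  measurable_H : Measurable (Function.uncurry H)
  integrable_Z : Integrable Z P
  integrable_H : ∀ θ, Integrable (fun ω => H θ (X ω)) P
  expectation_eq : ∀ θ, ∫ ω, Z ω ∂P = ∫ ω, H θ (X ω) ∂P
  variance_finite : ∀ θ, evariance (fun ω => H θ (X ω)) P < ⊤

/-- The variance function `v(θ) = Var(H(θ, X))`. -/
noncomputable def v {d m : ℕ} {Ω : Type*} [MeasurableSpace Ω] (P : Measure Ω)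
    (X : Ω → EuclideanSpace ℝ (Fin m))
    (H : EuclideanSpace ℝ (Fin d) → EuclideanSpace ℝ (Fin m) → ℝ)
    (θ : EuclideanSpace ℝ (Fin d)) : ℝ :=
  variance (fun ω => H θ (X ω)) P

/-- The moment function `s_p(θ) = 𝔼 |H(θ, X)|^p`. -/
noncomputable def s {d m : ℕ} {Ω : Type*} [MeasurableSpace Ω] (P : Measure Ω)
    (X : Ω → EuclideanSpace ℝ (Fin m))
    (H : EuclideanSpace ℝ (Fin d) → EuclideanSpace ℝ (Fin m) → ℝ) (p : ℝ)
    (θ : EuclideanSpace ℝ (Fin d)) : ℝ :=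
  ∫ ω, |H θ (X ω)| ^ p ∂P

/-- The adaptive estimator `ξ n = (1 / n) ∑_{i = 1}^{n} H(θ_{i - 1}, X_i)`, with `ξ 0 = 0`. -/
noncomputable def ξ {d m : ℕ} {Ω : Type*}
    (H : EuclideanSpace ℝ (Fin d) → EuclideanSpace ℝ (Fin m) → ℝ)
    (θ : ℕ → Ω → EuclideanSpace ℝ (Fin d)) (X : ℕ → Ω → EuclideanSpace ℝ (Fin m))
    (n : ℕ) (ω : Ω) : ℝ :=
  (1 / (n : ℝ)) * ∑ i ∈ Finset.range n, H (θ i ω) (X (i + 1) ω)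

end AdaptiveIS

/-!
The proof computes characteristic functions directly, without a martingale central limit theorem,
and concludes by Lévy's continuity theorem.

Let `G(θ, x) = H(θ, x) - 𝔼 Z`, which is centered under the law `ν` of `X` with variance `v(θ)`, and
let `S k` be the sum of the first `k` terms `G(θ j, X (j + 1))`. Since `X (k + 1)` is independent of
`ℱ k`, which carries `S k` and `θ k`, integrating over `X (k + 1)` first gives
`𝔼 exp(i a S (k + 1)) = 𝔼 [exp(i a S k) φ(θ k)]`, with `φ(θ)` the characteristic function of
`G(θ, X)` at `a` (`norm_integral_exp_add_sub_le`). A Taylor expansion with the moment of order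
`2 + δ` (`norm_integral_exp_sub_gaussian_le`) shows that `φ(θ k)` differs from the deterministic
`q = exp(-a² σ² / 2)`, where `σ² = v(θ_lim)`, by at most
`a² |v(θ k) - σ²| / 2 + O(|a| ^ (2 + δ)) + O(a⁴)`. As `|q| ≤ 1`, these errors simply add up over `n`
steps (`norm_sub_pow_le_sum`). At `a = t / √n` the total tends to `0`, because
`𝔼 |v(θ k) - σ²| → 0` by dominated convergence, hence also in Cesàro mean, whereas
`q ^ n = exp(-t² σ² / 2)` (`tendsto_integral_exp_sum`).

This needs bounds on the moments that are uniform in `θ`, while the hypotheses bound them only near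
`θ_lim`. So `θ k` is first replaced by `θ_lim` whenever it lies outside a small ball
(`retractToBall`). Almost surely this affects finitely many terms only, whose contribution vanishes
after division by `√n`, and Slutsky's lemma removes the truncation.
-/

namespace AdaptiveIS

/-! ### Elementary inequalities -/

/-- Second order Taylor bound for `exp (i x)` with an error `O(|x| ^ (2 + δ))` on the whole line:
for `|x| ≤ 1` this weakens the cubic error term, for `|x| ≥ 1` all terms are at most quadratic.
It is what lets a moment of order `2 + δ` replace a third moment. -/
lemma norm_exp_mul_I_sub_taylor_le {δ : ℝ} (hδ : 0 ≤ δ) (hδ1 : δ ≤ 1) (x : ℝ) :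
    ‖Complex.exp (x * Complex.I) - (1 + x * Complex.I - x ^ 2 / 2)‖ ≤ 4 * |x| ^ (2 + δ) := by
  rcases le_total |x| 1 with hx | hx
  · have h := Complex.exp_bound (x := x * Complex.I) (by simpa using hx) (n := 3) (by norm_num)
    have hsum : ∑ m ∈ Finset.range 3, ((x : ℂ) * Complex.I) ^ m / (m.factorial : ℂ)
        = 1 + x * Complex.I - x ^ 2 / 2 := by
      simp [Finset.sum_range_succ, Nat.factorial, mul_pow]
      ring
    rw [hsum] at h
    have h3 : |x| ^ 3 ≤ |x| ^ (2 + δ) := by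
      rcases (abs_nonneg x).eq_or_lt with h0 | h0
      · rw [← h0, Real.zero_rpow (by linarith)]; norm_num
      · rw [← Real.rpow_natCast]
        exact Real.rpow_le_rpow_of_exponent_ge h0 hx (by push_cast; linarith)
    refine h.trans ?_
    have : ‖(x : ℂ) * Complex.I‖ = |x| := by simp
    rw [this]
    norm_num [Nat.factorial]
    nlinarith [pow_nonneg (abs_nonneg x) 3]
  · have h2 : |x| ^ 2 ≤ |x| ^ (2 + δ) := by
      rw [← Real.rpow_natCast]
      exact Real.rpow_le_rpow_of_exponent_le hx (by push_cast; linarith)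
    have e1 : ‖Complex.exp (x * Complex.I)‖ = 1 := Complex.norm_exp_ofReal_mul_I x
    have e2 : ‖(1 : ℂ) + x * Complex.I - x ^ 2 / 2‖ ≤ 1 + |x| + |x| ^ 2 / 2 := by
      refine (norm_sub_le _ _).trans (add_le_add ((norm_add_le _ _).trans ?_) ?_) <;> simp
    have := norm_sub_le (Complex.exp (x * Complex.I)) (1 + x * Complex.I - x ^ 2 / 2)
    nlinarith

lemma abs_exp_neg_sub_le {x : ℝ} (hx : 0 ≤ x) : |Real.exp (-x) - (1 - x)| ≤ x ^ 2 := by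
  rw [abs_of_nonneg (by linarith [Real.add_one_le_exp (-x)])]
  rcases le_total x 1 with h | h
  · have := (abs_le.mp (Real.abs_exp_sub_one_sub_id_le (x := -x)
      (by rwa [abs_neg, abs_of_nonneg hx]))).2
    linarith [neg_sq x]
  · nlinarith [Real.exp_le_one_iff.mpr (neg_nonpos.mpr hx)]

lemma rpow_le_one_add_rpow {p q y : ℝ} (hp : 0 ≤ p) (hpq : p ≤ q) (hy : 0 ≤ y) :
    y ^ p ≤ 1 + y ^ q := by
  rcases le_total y 1 with h | h
  · linarith [Real.rpow_le_one hy h hp, Real.rpow_nonneg hy q]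
  · linarith [Real.rpow_le_rpow_of_exponent_le h hpq]

lemma sq_le_one_add_rpow {δ : ℝ} (hδ : 0 ≤ δ) (x : ℝ) : x ^ 2 ≤ 1 + |x| ^ (2 + δ) := by
  rw [← sq_abs, ← Real.rpow_two]
  exact rpow_le_one_add_rpow zero_le_two (by linarith) (abs_nonneg x)

lemma abs_sub_rpow_le {p : ℝ} (hp : 0 ≤ p) (x c : ℝ) :
    |x - c| ^ p ≤ 2 ^ p * (|x| ^ p + |c| ^ p) := by
  have hx := Real.rpow_nonneg (abs_nonneg x) p
  have hc := Real.rpow_nonneg (abs_nonneg c) p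
  have h2 : |x - c| ≤ 2 * max |x| |c| := by
    have := abs_sub x c
    linarith [le_max_left |x| |c|, le_max_right |x| |c|]
  refine (Real.rpow_le_rpow (abs_nonneg _) h2 hp).trans ?_
  rw [Real.mul_rpow (by norm_num) (le_max_of_le_left (abs_nonneg x))]
  refine mul_le_mul_of_nonneg_left ?_ (by positivity)
  rcases max_choice |x| |c| with h | h <;> rw [h] <;> linarith

/-! ### Characteristic functions of centered variables -/

section OneStep

variable {E : Type*} [MeasurableSpace E] {ν : Measure E} [IsProbabilityMeasure ν]

/-- The characteristic function at `a` of a centered `f` with variance `∫ f²` is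
`1 - a² ∫ f² / 2`, up to an error controlled by the absolute moment of order `2 + δ`. -/
lemma norm_integral_exp_sub_taylor_le {δ : ℝ} (hδ : 0 ≤ δ) (hδ1 : δ ≤ 1) {f : E → ℝ}
    (hf : Measurable f) (hf1 : Integrable f ν) (hf0 : ∫ x, f x ∂ν = 0)
    (hfδ : Integrable (fun x => |f x| ^ (2 + δ)) ν) (a : ℝ) :
    ‖∫ x, Complex.exp ((a * f x : ℝ) * Complex.I) ∂ν - (1 - a ^ 2 * ((∫ x, f x ^ 2 ∂ν : ℝ) : ℂ) / 2)‖
      ≤ 4 * |a| ^ (2 + δ) * ∫ x, |f x| ^ (2 + δ) ∂ν := by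
  have hf2 : Integrable (fun x => f x ^ 2) ν := by
    refine ((integrable_const 1).add hfδ).mono' (by fun_prop) (ae_of_all _ fun x => ?_)
    rw [Real.norm_of_nonneg (sq_nonneg _)]
    exact sq_le_one_add_rpow hδ _
  have hexp : Integrable (fun x => Complex.exp ((a * f x : ℝ) * Complex.I)) ν := by
    refine Integrable.of_bound (by fun_prop) 1 (ae_of_all _ fun x => ?_)
    rw [Complex.norm_exp_ofReal_mul_I]
  have hlin : Integrable (fun x => ((a * f x : ℝ) : ℂ) * Complex.I) ν :=
    (hf1.const_mul a).ofReal.mul_const _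
  have hsq : Integrable (fun x => ((a * f x : ℝ) : ℂ) ^ 2 / 2) ν := by
    have : (fun x => ((a * f x : ℝ) : ℂ) ^ 2 / 2) = fun x => ((a ^ 2 * f x ^ 2 / 2 : ℝ) : ℂ) := by
      ext x; push_cast; ring
    rw [this]
    exact ((hf2.const_mul _).div_const _).ofReal
  have hadd : Integrable (fun x => 1 + ((a * f x : ℝ) : ℂ) * Complex.I) ν :=
    (integrable_const _).add hlin
  have hpoly : ∫ x, (1 + ((a * f x : ℝ) : ℂ) * Complex.I - ((a * f x : ℝ) : ℂ) ^ 2 / 2) ∂ν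
      = 1 - a ^ 2 * ((∫ x, f x ^ 2 ∂ν : ℝ) : ℂ) / 2 := by
    rw [integral_sub hadd hsq, integral_add (integrable_const _) hlin, integral_mul_const,
      integral_complex_ofReal, integral_const_mul, hf0, integral_div]
    have : ∫ x, ((a * f x : ℝ) : ℂ) ^ 2 ∂ν = ((∫ x, a ^ 2 * f x ^ 2 ∂ν : ℝ) : ℂ) := by
      rw [← integral_complex_ofReal]
      congr with x; push_cast; ring
    rw [this, integral_const_mul]
    simp
  have hpolyi : Integrable
      (fun x => 1 + ((a * f x : ℝ) : ℂ) * Complex.I - ((a * f x : ℝ) : ℂ) ^ 2 / 2) ν :=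
    hadd.sub hsq
  rw [← hpoly, ← integral_sub hexp hpolyi, ← integral_const_mul]
  refine norm_integral_le_of_norm_le (hfδ.const_mul _) (ae_of_all _ fun x => ?_)
  refine (norm_exp_mul_I_sub_taylor_le hδ hδ1 _).trans_eq ?_
  rw [abs_mul, Real.mul_rpow (abs_nonneg _) (abs_nonneg _)]
  ring

/-- The characteristic function at `a` of a centered `f`, compared with that of a Gaussian variable
whose variance `σ2` need not be the variance of `f`. -/
lemma norm_integral_exp_sub_gaussian_le {δ : ℝ} (hδ : 0 ≤ δ) (hδ1 : δ ≤ 1) {f : E → ℝ}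
    (hf : Measurable f) (hf1 : Integrable f ν) (hf0 : ∫ x, f x ∂ν = 0)
    (hfδ : Integrable (fun x => |f x| ^ (2 + δ)) ν) (a : ℝ) {σ2 : ℝ} (hσ : 0 ≤ σ2) :
    ‖∫ x, Complex.exp ((a * f x : ℝ) * Complex.I) ∂ν - Real.exp (-(a ^ 2 * σ2 / 2))‖
      ≤ a ^ 2 / 2 * |∫ x, f x ^ 2 ∂ν - σ2| + 4 * |a| ^ (2 + δ) * ∫ x, |f x| ^ (2 + δ) ∂ν
        + (a ^ 2 * σ2 / 2) ^ 2 := by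
  have h1 := norm_integral_exp_sub_taylor_le hδ hδ1 hf hf1 hf0 hfδ a
  have h2 := abs_exp_neg_sub_le (x := a ^ 2 * σ2 / 2) (by positivity)
  have h3 : ‖((Real.exp (-(a ^ 2 * σ2 / 2)) - (1 - a ^ 2 * σ2 / 2) : ℝ) : ℂ)‖
      ≤ (a ^ 2 * σ2 / 2) ^ 2 := by
    rwa [Complex.norm_real, Real.norm_eq_abs]
  have h4 : ‖((a ^ 2 / 2 * (∫ x, f x ^ 2 ∂ν - σ2) : ℝ) : ℂ)‖
      = a ^ 2 / 2 * |∫ x, f x ^ 2 ∂ν - σ2| := by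
    rw [Complex.norm_real, Real.norm_eq_abs, abs_mul, abs_of_nonneg (by positivity)]
  set I1 := ∫ x, Complex.exp ((a * f x : ℝ) * Complex.I) ∂ν
  set w := ∫ x, f x ^ 2 ∂ν
  have h5 : I1 - Real.exp (-(a ^ 2 * σ2 / 2)) = (I1 - (1 - a ^ 2 * (w : ℝ) / 2))
      - ((a ^ 2 / 2 * (w - σ2) : ℝ) : ℂ)
      - ((Real.exp (-(a ^ 2 * σ2 / 2)) - (1 - a ^ 2 * σ2 / 2) : ℝ) : ℂ) := by
    push_cast; ring
  rw [h5]
  refine (norm_sub_le _ _).trans (add_le_add ((norm_sub_le _ _).trans ?_) h3)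
  linarith

/-! ### Adding an independent term -/

variable {Ω S : Type*} {mΩ : MeasurableSpace Ω} [MeasurableSpace S] {P : Measure Ω}
  [IsProbabilityMeasure P]

/-- Freezing: an independent argument may be integrated out first. -/
lemma integral_of_indepFun {U : Ω → S} {Y : Ω → E} (hU : Measurable U)
    (hY : Measurable Y) (hlaw : P.map Y = ν) (hind : IndepFun U Y P) {F : S → E → ℂ}
    (hF : Measurable (Function.uncurry F)) {C : ℝ} (hC : ∀ u y, ‖F u y‖ ≤ C) :
    ∫ ω, F (U ω) (Y ω) ∂P = ∫ ω, ∫ y, F (U ω) y ∂ν ∂P := by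
  have : IsProbabilityMeasure (P.map U) := Measure.isProbabilityMeasure_map hU.aemeasurable
  have hmap := (indepFun_iff_map_prod_eq_prod_map_map hU.aemeasurable hY.aemeasurable).mp hind
  rw [hlaw] at hmap
  have e1 : ∫ ω, F (U ω) (Y ω) ∂P = ∫ p, Function.uncurry F p ∂(P.map fun ω => (U ω, Y ω)) := by
    rw [integral_map (by fun_prop) hF.aestronglyMeasurable]; rfl
  rw [e1, hmap, integral_prod _ (Integrable.of_bound hF.aestronglyMeasurable C
    (ae_of_all _ fun p => hC _ _)), integral_map hU.aemeasurable]
  · rfl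
  · exact hF.stronglyMeasurable.integral_prod_right'.aestronglyMeasurable

/-- One step of the recursion for characteristic functions: if `Y` is independent of `(A, τ)`,
adding `G(τ, Y)` to `A` multiplies the characteristic function by `z`, up to the mean distance from `z` of
the characteristic function of `G(t, Y)` at the random parameter `t = τ`. -/
lemma norm_integral_exp_add_sub_le {T : Type*} [MeasurableSpace T] {G : T → E → ℝ}
    (hG : Measurable (Function.uncurry G)) {A : Ω → ℝ} {τ : Ω → T} {Y : Ω → E}
    (hA : Measurable A) (hτ : Measurable τ) (hY : Measurable Y) (hlaw : P.map Y = ν)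
    (hind : IndepFun (fun ω => (A ω, τ ω)) Y P) (a : ℝ) (z : ℂ) :
    ‖∫ ω, Complex.exp ((a * (A ω + G (τ ω) (Y ω)) : ℝ) * Complex.I) ∂P
        - z * ∫ ω, Complex.exp ((a * A ω : ℝ) * Complex.I) ∂P‖
      ≤ ∫ ω, ‖∫ y, Complex.exp ((a * G (τ ω) y : ℝ) * Complex.I) ∂ν - z‖ ∂P := by
  have hGτ : Measurable fun p : T × E => G p.1 p.2 := hG
  have key := integral_of_indepFun (ν := ν) (P := P) (hA.prodMk hτ) hY hlaw hind
    (F := fun u y => Complex.exp ((a * (u.1 + G u.2 y) : ℝ) * Complex.I))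
    (by
      have : Measurable fun p : (ℝ × T) × E => G p.1.2 p.2 :=
        hGτ.comp (measurable_fst.snd.prodMk measurable_snd)
      simp only [Function.uncurry_def]
      fun_prop) (C := 1) (fun u y => (Complex.norm_exp_ofReal_mul_I _).le)
  have hφ : Measurable fun t => ∫ y, Complex.exp ((a * G t y : ℝ) * Complex.I) ∂ν := by
    have : Measurable fun p : T × E => Complex.exp ((a * G p.1 p.2 : ℝ) * Complex.I) := by fun_prop
    exact this.stronglyMeasurable.integral_prod_right'.measurable
  have hφ1 : ∀ t, ‖∫ y, Complex.exp ((a * G t y : ℝ) * Complex.I) ∂ν‖ ≤ 1 := fun t => by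
    refine (norm_integral_le_of_norm_le (integrable_const (1 : ℝ))
      (ae_of_all _ fun y => (Complex.norm_exp_ofReal_mul_I _).le)).trans_eq (by simp)
  have hφτ := hφ.comp hτ
  simp only [Function.comp_def] at hφτ
  -- `exp (i a A)` does not depend on the variable that is integrated out
  have hin : ∀ ω, ∫ y, Complex.exp ((a * (A ω + G (τ ω) y) : ℝ) * Complex.I) ∂ν
      = Complex.exp ((a * A ω : ℝ) * Complex.I)
        * ∫ y, Complex.exp ((a * G (τ ω) y : ℝ) * Complex.I) ∂ν := fun ω => by
    rw [← integral_const_mul]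
    congr with y
    rw [← Complex.exp_add]; push_cast; ring_nf
  have hi1 : Integrable (fun ω => Complex.exp ((a * A ω : ℝ) * Complex.I)) P :=
    Integrable.of_bound (by fun_prop) 1 (ae_of_all _ fun ω => (Complex.norm_exp_ofReal_mul_I _).le)
  have hi2 : Integrable (fun ω => Complex.exp ((a * A ω : ℝ) * Complex.I)
        * ∫ y, Complex.exp ((a * G (τ ω) y : ℝ) * Complex.I) ∂ν) P := by
    refine Integrable.of_bound (by fun_prop) 1 (ae_of_all _ fun ω => ?_)
    rw [norm_mul, Complex.norm_exp_ofReal_mul_I, one_mul]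
    exact hφ1 _
  have hi3 : Integrable (fun ω => ∫ y, Complex.exp ((a * G (τ ω) y : ℝ) * Complex.I) ∂ν - z) P :=
    (Integrable.of_bound hφτ.aestronglyMeasurable 1 (ae_of_all _ fun ω => hφ1 _)).sub
      (integrable_const z)
  simp only at key
  rw [key]
  simp_rw [hin]
  rw [← integral_const_mul, ← integral_sub hi2 (hi1.const_mul z)]
  refine norm_integral_le_of_norm_le hi3.norm (ae_of_all _ fun ω => ?_)
  rw [mul_comm z, ← mul_sub, norm_mul, Complex.norm_exp_ofReal_mul_I, one_mul]

end OneStep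

/-- Telescoping: a sequence that is nearly geometric with ratio `q` in the closed unit disc stays
close to `q ^ n`, the errors adding up without amplification. -/
lemma norm_sub_pow_le_sum {u : ℕ → ℂ} {q : ℂ} {ε : ℕ → ℝ} (hq : ‖q‖ ≤ 1) (h0 : u 0 = 1)
    (h : ∀ k, ‖u (k + 1) - q * u k‖ ≤ ε k) (n : ℕ) :
    ‖u n - q ^ n‖ ≤ ∑ k ∈ Finset.range n, ε k := by
  induction n with
  | zero => simp [h0]
  | succ n ih =>
    rw [Finset.sum_range_succ]
    have : u (n + 1) - q ^ (n + 1) = q * (u n - q ^ n) + (u (n + 1) - q * u n) := by ring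
    rw [this]
    refine (norm_add_le _ _).trans (add_le_add ?_ (h n))
    rw [norm_mul]
    exact (mul_le_of_le_one_left (norm_nonneg _) hq).trans ih

/-! ### Central limit theorem for adaptive integrands -/

/-- Characteristic function form of the central limit theorem below. With `a = t / √n`, each of the
`n` steps is compared with the factor `exp (-a² σ2 / 2)`; the step errors sum to `t² / 2` times the
Cesàro mean of `𝔼 |w(τ k) - σ2|`, where `w(t) = ∫ G(t, ·)²`, plus terms of order `n ^ (-δ / 2)` and
`1 / n`. -/
lemma tendsto_integral_exp_sum {E T Ω : Type*} [MeasurableSpace E] [MeasurableSpace T]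
    {mΩ : MeasurableSpace Ω} {P : Measure Ω} [IsProbabilityMeasure P]
    {ν : Measure E} [IsProbabilityMeasure ν] {G : T → E → ℝ}
    (hG : Measurable (Function.uncurry G)) (hG1 : ∀ t, Integrable (G t) ν)
    (hG0 : ∀ t, ∫ x, G t x ∂ν = 0) {δ C : ℝ} (hδ : 0 < δ) (hδ1 : δ ≤ 1)
    (hGδ : ∀ t, Integrable (fun x => |G t x| ^ (2 + δ)) ν)
    (hC : ∀ t, ∫ x, |G t x| ^ (2 + δ) ∂ν ≤ C)
    {ℱ : Filtration ℕ mΩ} {τ : ℕ → Ω → T} (hτ : Adapted ℱ τ) {Y : ℕ → Ω → E}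
    (hYℱ : ∀ k, Measurable[ℱ (k + 1)] (Y k)) (hlaw : ∀ k, P.map (Y k) = ν)
    (hind : ∀ k, Indep (ℱ k) (MeasurableSpace.comap (Y k) inferInstance) P)
    {σ2 : ℝ} (hσ : 0 ≤ σ2)
    (hw : ∀ᵐ ω ∂P, Tendsto (fun k => ∫ x, G (τ k ω) x ^ 2 ∂ν) atTop (𝓝 σ2)) (t : ℝ) :
    Tendsto (fun n : ℕ => ∫ ω, Complex.exp
        (((√n)⁻¹ * t * ∑ k ∈ Finset.range n, G (τ k ω) (Y k ω) : ℝ) * Complex.I) ∂P)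
      atTop (𝓝 (Real.exp (-(t ^ 2 * σ2 / 2)))) := by
  have hY : ∀ k, Measurable (Y k) := fun k => (hYℱ k).mono (ℱ.le _) le_rfl
  have hτm : ∀ k, Measurable (τ k) := fun k => hτ.measurable
  set w : T → ℝ := fun t => ∫ x, G t x ^ 2 ∂ν
  have hGm : ∀ t, Measurable (G t) := fun t => hG.comp measurable_prodMk_left
  have hwm : Measurable w := by
    have : Measurable fun p : T × E => G p.1 p.2 ^ 2 := hG.pow_const 2
    exact this.stronglyMeasurable.integral_prod_right'.measurable
  have hw0 : ∀ t, 0 ≤ w t := fun t => integral_nonneg fun x => sq_nonneg _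
  -- `C` also bounds the second moments, which gives dominated convergence of `w(τ k)`
  have hwC : ∀ t, w t ≤ 1 + C := fun t => by
    have : w t ≤ ∫ x, (1 + |G t x| ^ (2 + δ)) ∂ν :=
      integral_mono_of_nonneg (ae_of_all _ fun x => sq_nonneg _)
        ((integrable_const 1).add (hGδ t)) (ae_of_all _ fun x => sq_le_one_add_rpow hδ.le _)
    rw [integral_add (integrable_const 1) (hGδ t)] at this
    have h1 : ∫ _ : E, (1 : ℝ) ∂ν = 1 := by simp
    linarith [hC t]
  have hwb : ∀ t, |w t - σ2| ≤ 1 + C + σ2 := fun t => by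
    rw [abs_le]; constructor <;> linarith [hw0 t, hwC t]
  have hwτm : ∀ k, Measurable fun ω => |w (τ k ω) - σ2| := fun k =>
    (((hwm.comp (hτm k)).sub_const σ2)).abs
  have hwi : ∀ k, Integrable (fun ω => |w (τ k ω) - σ2|) P := fun k =>
    Integrable.of_bound (hwτm k).aestronglyMeasurable (1 + C + σ2)
      (ae_of_all _ fun ω => by rw [Real.norm_eq_abs, abs_abs]; exact hwb _)
  have hL1 : Tendsto (fun k => ∫ ω, |w (τ k ω) - σ2| ∂P) atTop (𝓝 0) := by
    have := tendsto_integral_of_dominated_convergence (μ := P)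
      (F := fun k ω => |w (τ k ω) - σ2|) (f := fun _ => 0) (fun _ => 1 + C + σ2)
      (fun k => (hwτm k).aestronglyMeasurable) (integrable_const _)
      (fun k => ae_of_all _ fun ω => by rw [Real.norm_eq_abs, abs_abs]; exact hwb _)
      (by
        filter_upwards [hw] with ω hω
        have := (hω.sub_const σ2).abs
        simpa using this)
    simpa using this
  set D : ℕ → ℝ := fun k => ∫ ω, |w (τ k ω) - σ2| ∂P with hD
  -- adaptedness of the partial sums
  have hGY : ∀ j k, j < k → Measurable[ℱ k] fun ω => G (τ j ω) (Y j ω) := fun j k hjk =>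
    hG.comp (((hτ j).mono (ℱ.mono hjk.le) le_rfl).prodMk
      ((hYℱ j).mono (ℱ.mono hjk) le_rfl))
  have hSℱ : ∀ k, Measurable[ℱ k] fun ω => ∑ j ∈ Finset.range k, G (τ j ω) (Y j ω) := fun k =>
    Finset.measurable_sum _ fun j hj => hGY j k (Finset.mem_range.mp hj)
  have hind' : ∀ k, IndepFun (fun ω => (∑ j ∈ Finset.range k, G (τ j ω) (Y j ω), τ k ω)) (Y k) P :=
    fun k => indep_of_indep_of_le_left (hind k)
      (measurable_iff_comap_le.mp ((hSℱ k).prodMk (hτ k)))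
  have hstep : ∀ (a : ℝ) (n : ℕ),
      ‖∫ ω, Complex.exp ((a * ∑ k ∈ Finset.range n, G (τ k ω) (Y k ω) : ℝ) * Complex.I) ∂P
        - ((Real.exp (-(a ^ 2 * σ2 / 2)) : ℝ) : ℂ) ^ n‖
      ≤ ∑ k ∈ Finset.range n, (a ^ 2 / 2 * D k + 4 * |a| ^ (2 + δ) * C + (a ^ 2 * σ2 / 2) ^ 2) := by
    intro a n
    refine norm_sub_pow_le_sum (u := fun n => ∫ ω, Complex.exp
      ((a * ∑ k ∈ Finset.range n, G (τ k ω) (Y k ω) : ℝ) * Complex.I) ∂P) ?_ (by simp) ?_ n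
    · rw [Complex.norm_real, Real.norm_eq_abs, Real.abs_exp, Real.exp_le_one_iff]
      have : 0 ≤ a ^ 2 * σ2 / 2 := by positivity
      linarith
    · intro k
      have := norm_integral_exp_add_sub_le hG ((hSℱ k).mono (ℱ.le k) le_rfl) (hτm k) (hY k)
        (hlaw k) (hind' k) a ((Real.exp (-(a ^ 2 * σ2 / 2)) : ℝ) : ℂ)
      simp only [Finset.sum_range_succ]
      refine this.trans ?_
      have hi : Integrable (fun ω => a ^ 2 / 2 * |w (τ k ω) - σ2| + 4 * |a| ^ (2 + δ) * C
          + (a ^ 2 * σ2 / 2) ^ 2) P :=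
        (((hwi k).const_mul _).add (integrable_const _)).add (integrable_const _)
      calc _ ≤ ∫ ω, (a ^ 2 / 2 * |w (τ k ω) - σ2| + 4 * |a| ^ (2 + δ) * C
          + (a ^ 2 * σ2 / 2) ^ 2) ∂P := by
            refine integral_mono_of_nonneg (ae_of_all _ fun _ => norm_nonneg _) hi
              (ae_of_all _ fun ω => ?_)
            refine (norm_integral_exp_sub_gaussian_le hδ.le hδ1 (hGm _) (hG1 _) (hG0 _) (hGδ _) a
              hσ).trans ?_
            exact add_le_add (add_le_add le_rfl
              (mul_le_mul_of_nonneg_left (hC _) (by positivity))) le_rfl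
        _ = _ := by
            have h1 : Integrable (fun ω => a ^ 2 / 2 * |w (τ k ω) - σ2| + 4 * |a| ^ (2 + δ) * C) P :=
              ((hwi k).const_mul _).add (integrable_const _)
            rw [integral_add h1 (integrable_const _),
              integral_add ((hwi k).const_mul _) (integrable_const _), integral_const_mul]
            simp [hD]
  -- the error bound for `a = t / √n`
  have hbound : ∀ n : ℕ, 1 ≤ n →
      ‖∫ ω, Complex.exp (((√n)⁻¹ * t * ∑ k ∈ Finset.range n, G (τ k ω) (Y k ω) : ℝ)
          * Complex.I) ∂P - ((Real.exp (-(t ^ 2 * σ2 / 2)) : ℝ) : ℂ)‖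
      ≤ t ^ 2 / 2 * ((n : ℝ)⁻¹ * ∑ k ∈ Finset.range n, D k)
        + 4 * |t| ^ (2 + δ) * C * (√n)⁻¹ ^ δ + (t ^ 2 * σ2 / 2) ^ 2 * (n : ℝ)⁻¹ := by
    intro n hn
    have hn0 : (0 : ℝ) < n := by exact_mod_cast hn
    have hsq : (√(n : ℝ))⁻¹ ^ 2 = (n : ℝ)⁻¹ := by rw [inv_pow, Real.sq_sqrt hn0.le]
    have ha2 : ((√(n : ℝ))⁻¹ * t) ^ 2 = (n : ℝ)⁻¹ * t ^ 2 := by rw [mul_pow, hsq]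
    have hpow : ((Real.exp (-(((√(n : ℝ))⁻¹ * t) ^ 2 * σ2 / 2)) : ℝ) : ℂ) ^ n
        = ((Real.exp (-(t ^ 2 * σ2 / 2)) : ℝ) : ℂ) := by
      rw [← Complex.ofReal_pow, ← Real.exp_nat_mul, ha2]
      congr 3
      field_simp
    have hdpow : |(√(n : ℝ))⁻¹ * t| ^ (2 + δ) = (n : ℝ)⁻¹ * ((√n)⁻¹ ^ δ * |t| ^ (2 + δ)) := by
      have hp : (0 : ℝ) < (√(n : ℝ))⁻¹ := by positivity
      rw [abs_mul, abs_of_pos hp, Real.mul_rpow hp.le (abs_nonneg _), Real.rpow_add hp,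
        Real.rpow_two, hsq, mul_assoc]
    have := hstep ((√n)⁻¹ * t) n
    rw [hpow] at this
    refine this.trans_eq ?_
    rw [Finset.sum_add_distrib, Finset.sum_add_distrib, ← Finset.mul_sum, hdpow, ha2]
    simp only [Finset.sum_const, Finset.card_range, nsmul_eq_mul]
    field_simp
  have hlim : Tendsto (fun n : ℕ => t ^ 2 / 2 * ((n : ℝ)⁻¹ * ∑ k ∈ Finset.range n, D k)
        + 4 * |t| ^ (2 + δ) * C * (√n)⁻¹ ^ δ + (t ^ 2 * σ2 / 2) ^ 2 * (n : ℝ)⁻¹) atTop (𝓝 0) := by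
    have h1 := hL1.cesaro.const_mul (t ^ 2 / 2)
    have hs : Tendsto (fun n : ℕ => (√(n : ℝ))⁻¹) atTop (𝓝 0) :=
      tendsto_inv_atTop_zero.comp (Real.tendsto_sqrt_atTop.comp tendsto_natCast_atTop_atTop)
    have h2 := (hs.rpow_const (p := δ) (Or.inr hδ.le)).const_mul (4 * |t| ^ (2 + δ) * C)
    have h3 := (tendsto_inv_atTop_nhds_zero_nat (𝕜 := ℝ)).const_mul ((t ^ 2 * σ2 / 2) ^ 2)
    rw [Real.zero_rpow hδ.ne'] at h2
    simpa using (h1.add h2).add h3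
  rw [tendsto_iff_norm_sub_tendsto_zero]
  refine squeeze_zero' (Eventually.of_forall fun _ => norm_nonneg _) ?_ hlim
  filter_upwards [eventually_ge_atTop 1] with n hn using hbound n hn

/-- Central limit theorem for adaptively chosen integrands: `G(t, ·)` is centered with a moment of
order `2 + δ` bounded uniformly in `t`, the parameter `τ k` depends only on the past, the new
sample `Y k` is independent of the past, and the conditional variances `∫ G(τ k, ·)²` converge
almost surely to the constant `σ2`. -/
theorem tendstoInDistribution_inv_sqrt_mul_sum {E T Ω : Type*} [MeasurableSpace E]
    [MeasurableSpace T]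
    {mΩ : MeasurableSpace Ω} {P : Measure Ω} [IsProbabilityMeasure P]
    {ν : Measure E} [IsProbabilityMeasure ν] {G : T → E → ℝ}
    (hG : Measurable (Function.uncurry G)) (hG1 : ∀ t, Integrable (G t) ν)
    (hG0 : ∀ t, ∫ x, G t x ∂ν = 0) {δ C : ℝ} (hδ : 0 < δ) (hδ1 : δ ≤ 1)
    (hGδ : ∀ t, Integrable (fun x => |G t x| ^ (2 + δ)) ν)
    (hC : ∀ t, ∫ x, |G t x| ^ (2 + δ) ∂ν ≤ C)
    {ℱ : Filtration ℕ mΩ} {τ : ℕ → Ω → T} (hτ : Adapted ℱ τ) {Y : ℕ → Ω → E}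
    (hYℱ : ∀ k, Measurable[ℱ (k + 1)] (Y k)) (hlaw : ∀ k, P.map (Y k) = ν)
    (hind : ∀ k, Indep (ℱ k) (MeasurableSpace.comap (Y k) inferInstance) P)
    {σ2 : ℝ} (hσ : 0 ≤ σ2)
    (hw : ∀ᵐ ω ∂P, Tendsto (fun k => ∫ x, G (τ k ω) x ^ 2 ∂ν) atTop (𝓝 σ2)) :
    TendstoInDistribution (fun (n : ℕ) ω => (√n)⁻¹ * ∑ k ∈ Finset.range n, G (τ k ω) (Y k ω))
      atTop (id : ℝ → ℝ) (fun _ => P) (gaussianReal 0 σ2.toNNReal) := by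
  have hterm : ∀ k, Measurable fun ω => G (τ k ω) (Y k ω) := fun k =>
    hG.comp (hτ.measurable.prodMk ((hYℱ k).mono (ℱ.le _) le_rfl))
  have hsum : ∀ n : ℕ,
      AEMeasurable (fun ω => (√n)⁻¹ * ∑ k ∈ Finset.range n, G (τ k ω) (Y k ω)) P := fun n =>
    ((Finset.measurable_sum _ fun k _ => hterm k).const_mul _).aemeasurable
  refine ⟨hsum, aemeasurable_id, ?_⟩
  refine ProbabilityMeasure.tendsto_iff_tendsto_charFun.2 fun t => ?_
  have h := tendsto_integral_exp_sum hG hG1 hG0 hδ hδ1 hGδ hC hτ hYℱ hlaw hind hσ hw t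
  simp only [ProbabilityMeasure.coe_mk, Measure.map_id]
  rw [charFun_gaussianReal]
  convert! h using 2 with n
  · rw [charFun_apply_real, integral_map (hsum n) (by fun_prop)]
    congr with ω
    congr 2
    push_cast
    ring
  · rw [Real.coe_toNNReal _ hσ]
    push_cast
    congr 1
    ring

/-! ### The sample filtration -/

lemma indep_sampleFiltration {Ω E : Type*} [mΩ : MeasurableSpace Ω] [MeasurableSpace E]
    {P : Measure Ω} {X : ℕ → Ω → E} (hX : ∀ n, 1 ≤ n → Measurable (X n))
    (hindep : iIndepFun (fun n : ℕ => X (n + 1)) P) (k : ℕ) :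
    Indep (sampleFiltration X hX k) (MeasurableSpace.comap (X (k + 1)) inferInstance) P := by
  have h := indep_iSup_of_disjoint (fun n => (hX (n + 1) (by omega)).comap_le) hindep.iIndep
    (S := Set.Iio k) (T := {k}) (by simp)
  refine indep_of_indep_of_le_left (indep_of_indep_of_le_right h ?_) ?_
  · simp
  · refine iSup₂_le fun i hi => ?_
    obtain ⟨h1, h2⟩ := Finset.mem_Icc.mp hi
    obtain ⟨j, rfl⟩ : ∃ j, i = j + 1 := ⟨i - 1, by omega⟩
    exact le_biSup (fun n => MeasurableSpace.comap (X (n + 1)) _) (show j ∈ Set.Iio k from h2)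

lemma measurable_sampleFiltration {Ω E : Type*} [mΩ : MeasurableSpace Ω] [MeasurableSpace E]
    {X : ℕ → Ω → E} (hX : ∀ n, 1 ≤ n → Measurable (X n)) (k : ℕ) :
    Measurable[sampleFiltration X hX (k + 1)] (X (k + 1)) := by
  rw [measurable_iff_comap_le]
  exact le_biSup (fun i => MeasurableSpace.comap (X i) _)
    (Finset.mem_Icc.mpr ⟨by omega, le_rfl⟩)

/-! ### Truncation of the parameters -/

open Classical in
/-- The map that fixes the points of the open ball of radius `r` around `c` and sends every other
point to `c`. It need not be continuous, but it is measurable, which is all that is needed to truncate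
an adapted sequence. -/
noncomputable def retractToBall {T : Type*} [PseudoMetricSpace T] (c : T) (r : ℝ) (t : T) : T :=
  if t ∈ Metric.ball c r then t else c

section retractToBall
variable {T : Type*} [PseudoMetricSpace T] {c t : T} {r : ℝ}

lemma retractToBall_of_mem (h : t ∈ Metric.ball c r) : retractToBall c r t = t := if_pos h

lemma retractToBall_mem (hr : 0 < r) (t : T) : retractToBall c r t ∈ Metric.ball c r := by
  unfold retractToBall
  split_ifs with h
  · exact h
  · exact Metric.mem_ball_self hr

lemma measurable_retractToBall [MeasurableSpace T] [OpensMeasurableSpace T] :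
    Measurable (retractToBall c r) :=
  Measurable.ite Metric.isOpen_ball.measurableSet measurable_id measurable_const
end retractToBall

lemma tendsto_inv_sqrt_mul_sum_of_eventually_zero {d : ℕ → ℝ} (hd : ∀ᶠ k in atTop, d k = 0) :
    Tendsto (fun n : ℕ => (√n)⁻¹ * ∑ k ∈ Finset.range n, d k) atTop (𝓝 0) := by
  obtain ⟨K, hK⟩ := eventually_atTop.mp hd
  have hs : Tendsto (fun n : ℕ => (√(n : ℝ))⁻¹) atTop (𝓝 0) :=
    tendsto_inv_atTop_zero.comp (Real.tendsto_sqrt_atTop.comp tendsto_natCast_atTop_atTop)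
  have h := hs.mul_const (∑ k ∈ Finset.range K, d k)
  rw [zero_mul] at h
  refine h.congr' ?_
  filter_upwards [eventually_ge_atTop K] with n hn
  rw [Finset.sum_subset (Finset.range_mono hn) fun x _ hx => hK x (by simpa using hx)]

end AdaptiveIS

/-! ### Adaptive estimators -/

theorem theorem2 {d m : ℕ}
    {Ω₀ : Type*} [MeasurableSpace Ω₀] (P₀ : Measure Ω₀) [IsProbabilityMeasure P₀]
    {Ω : Type*} [MeasurableSpace Ω] (P : Measure Ω) [IsProbabilityMeasure P]
    (Z : Ω₀ → ℝ) (X : Ω₀ → EuclideanSpace ℝ (Fin m)) (hX : Measurable X)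
    (H : EuclideanSpace ℝ (Fin d) → EuclideanSpace ℝ (Fin m) → ℝ)
    (hH : AdaptiveIS.IsParametricRepresentation P₀ Z X H)
    (Xs : ℕ → Ω → EuclideanSpace ℝ (Fin m))
    (hXs : ∀ n, 1 ≤ n → Measurable (Xs n))
    (hindep : iIndepFun (fun n : ℕ => Xs (n + 1)) P)
    (hlaw : ∀ n, 1 ≤ n → IdentDistrib (Xs n) X P P₀)
    (θ : ℕ → Ω → EuclideanSpace ℝ (Fin d))
    (hθ : Adapted (AdaptiveIS.sampleFiltration Xs hXs) θ)
    (θ_lim : EuclideanSpace ℝ (Fin d))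
    (hθ_lim : ∀ᵐ ω ∂P, Tendsto (fun n => θ n ω) atTop (𝓝 θ_lim))
    (η : ℝ) (hη : 0 < η)
    (hs_fin : ∀ t, Integrable (fun ω => |H t (X ω)| ^ (2 + η)) P₀)
    (hs_cont : ContinuousAt (AdaptiveIS.s P₀ X H (2 + η)) θ_lim)
    (hv_cont : ContinuousAt (AdaptiveIS.v P₀ X H) θ_lim)
    (hv_pos : 0 < AdaptiveIS.v P₀ X H θ_lim) :
    TendstoInDistribution
      (fun (n : ℕ) (ω : Ω) => √(n : ℝ) * (AdaptiveIS.ξ H θ Xs n ω - ∫ ω₀, Z ω₀ ∂P₀))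
      atTop (id : ℝ → ℝ) (fun _ => P)
      (gaussianReal 0 (AdaptiveIS.v P₀ X H θ_lim).toNNReal) := by
  obtain ⟨hHm, -, hH1, hHc, -⟩ := hH
  set c : ℝ := ∫ ω₀, Z ω₀ ∂P₀
  set ν : Measure (EuclideanSpace ℝ (Fin m)) := P₀.map X with hν
  have : IsProbabilityMeasure ν := Measure.isProbabilityMeasure_map hX.aemeasurable
  have hHt : ∀ t, Measurable (H t) := fun t => hHm.comp measurable_prodMk_left
  -- continuity of the moment function at `θ_lim` is used only for its boundedness on a ball
  obtain ⟨r, hr, hball⟩ : ∃ r > 0, ∀ t ∈ Metric.ball θ_lim r,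
      AdaptiveIS.s P₀ X H (2 + η) t < AdaptiveIS.s P₀ X H (2 + η) θ_lim + 1 :=
    Metric.eventually_nhds_iff_ball.mp (hs_cont.eventually_lt_const (lt_add_one _))
  set ρ := AdaptiveIS.retractToBall θ_lim r
  have hρm : Measurable ρ := AdaptiveIS.measurable_retractToBall
  set G : EuclideanSpace ℝ (Fin d) → EuclideanSpace ℝ (Fin m) → ℝ := fun t x => H (ρ t) x - c
  have hG : Measurable (Function.uncurry G) := by
    have : Measurable fun p : EuclideanSpace ℝ (Fin d) × EuclideanSpace ℝ (Fin m) =>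
        H (ρ p.1) p.2 := hHm.comp ((hρm.comp measurable_fst).prodMk measurable_snd)
    exact this.sub_const c
  have hGt : ∀ t, Measurable (G t) := fun t => (hHt _).sub_const c
  have hG1 : ∀ t, Integrable (G t) ν := fun t => by
    rw [hν, integrable_map_measure (hGt t).aestronglyMeasurable hX.aemeasurable]
    exact (hH1 _).sub (integrable_const c)
  have hG0 : ∀ t, ∫ x, G t x ∂ν = 0 := fun t => by
    rw [hν, integral_map hX.aemeasurable (hGt t).aestronglyMeasurable,
      integral_sub (hH1 _) (integrable_const c), ← hHc]
    simp
  have hG2 : ∀ t, ∫ x, G t x ^ 2 ∂ν = AdaptiveIS.v P₀ X H (ρ t) := fun t => by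
    rw [hν, integral_map hX.aemeasurable ((hGt t).pow_const 2).aestronglyMeasurable, AdaptiveIS.v,
      variance_eq_integral (X := fun ω => H (ρ t) (X ω)) ((hHt _).comp hX).aemeasurable, ← hHc]
  -- the Taylor bound needs an exponent `2 + δ` with `δ ≤ 1`; moments of order `2 + η` dominate it
  set δ := min η 1
  have hδ : 0 < δ := lt_min hη one_pos
  have hmom : ∀ t y, |G t y| ^ (2 + δ)
      ≤ 1 + 2 ^ (2 + η) * (|H (ρ t) y| ^ (2 + η) + |c| ^ (2 + η)) := fun t y =>
    (AdaptiveIS.rpow_le_one_add_rpow (by linarith) (by linarith [min_le_left η 1])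
      (abs_nonneg _)).trans
      (add_le_add le_rfl (AdaptiveIS.abs_sub_rpow_le (by linarith) _ _))
  have hmomi : ∀ t, Integrable
      (fun ω => 1 + 2 ^ (2 + η) * (|H (ρ t) (X ω)| ^ (2 + η) + |c| ^ (2 + η))) P₀ := fun t =>
    (integrable_const _).add (((hs_fin _).add (integrable_const _)).const_mul _)
  have hGpm : ∀ t, Measurable fun x => |G t x| ^ (2 + δ) := fun t => by
    have := hGt t
    fun_prop
  have hGδ : ∀ t, Integrable (fun x => |G t x| ^ (2 + δ)) ν := fun t => by
    rw [hν, integrable_map_measure (hGpm t).aestronglyMeasurable hX.aemeasurable]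
    refine (hmomi t).mono' ((hGpm t).comp hX).aestronglyMeasurable (ae_of_all _ fun ω => ?_)
    rw [Function.comp_apply, Real.norm_of_nonneg (Real.rpow_nonneg (abs_nonneg _) _)]
    exact hmom _ _
  have hC : ∀ t, ∫ x, |G t x| ^ (2 + δ) ∂ν
      ≤ 1 + 2 ^ (2 + η) * ((AdaptiveIS.s P₀ X H (2 + η) θ_lim + 1) + |c| ^ (2 + η)) := fun t => by
    rw [hν, integral_map hX.aemeasurable (hGpm t).aestronglyMeasurable]
    refine (integral_mono_of_nonneg (ae_of_all _ fun _ => Real.rpow_nonneg (abs_nonneg _) _)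
      (hmomi t) (ae_of_all _ fun ω => hmom t (X ω))).trans ?_
    have hi : Integrable (fun ω => |H (ρ t) (X ω)| ^ (2 + η) + |c| ^ (2 + η)) P₀ :=
      (hs_fin _).add (integrable_const _)
    have hle := (hball _ (AdaptiveIS.retractToBall_mem hr t)).le
    rw [integral_add (integrable_const _) (hi.const_mul _), integral_const_mul,
      integral_add (hs_fin _) (integrable_const _)]
    simp only [integral_const, probReal_univ, one_smul]
    exact add_le_add le_rfl (mul_le_mul_of_nonneg_left (add_le_add hle le_rfl) (by positivity))
  have hev : ∀ᵐ ω ∂P, ∀ᶠ k in atTop, ρ (θ k ω) = θ k ω := by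
    filter_upwards [hθ_lim] with ω hω
    filter_upwards [hω (Metric.ball_mem_nhds _ hr)] with k hk
    exact AdaptiveIS.retractToBall_of_mem hk
  have hw : ∀ᵐ ω ∂P, Tendsto (fun k => ∫ x, G (θ k ω) x ^ 2 ∂ν) atTop
      (𝓝 (AdaptiveIS.v P₀ X H θ_lim)) := by
    filter_upwards [hθ_lim, hev] with ω hω hev
    refine (hv_cont.tendsto.comp hω).congr' ?_
    filter_upwards [hev] with k hk
    rw [hG2, hk, Function.comp_apply]
  have key := AdaptiveIS.tendstoInDistribution_inv_sqrt_mul_sum hG hG1 hG0 hδ (min_le_right η 1)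
    hGδ hC hθ
    (Y := fun k => Xs (k + 1)) (AdaptiveIS.measurable_sampleFiltration hXs)
    (fun k => (hlaw (k + 1) (by omega)).map_eq) (AdaptiveIS.indep_sampleFiltration hXs hindep)
    hv_pos.le hw
  -- truncating the parameters changes only finitely many summands along almost every path
  have hterm : ∀ k, Measurable fun ω => H (θ k ω) (Xs (k + 1) ω) := fun k =>
    hHm.comp (hθ.measurable.prodMk (hXs _ (by omega)))
  have hξ : ∀ n : ℕ, AEMeasurable (fun ω => √(n : ℝ) * (AdaptiveIS.ξ H θ Xs n ω - c)) P := fun n =>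
    ((((Finset.measurable_sum _ fun k _ => hterm k).const_mul _).sub_const c).const_mul
      _).aemeasurable
  have hae : ∀ᵐ ω ∂P, Tendsto (fun n : ℕ => √(n : ℝ) * (AdaptiveIS.ξ H θ Xs n ω - c)
      - (√n)⁻¹ * ∑ k ∈ Finset.range n, G (θ k ω) (Xs (k + 1) ω)) atTop (𝓝 0) := by
    filter_upwards [hev] with ω hω
    have h0 := AdaptiveIS.tendsto_inv_sqrt_mul_sum_of_eventually_zero
      (d := fun k => H (θ k ω) (Xs (k + 1) ω) - H (ρ (θ k ω)) (Xs (k + 1) ω))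
      (hω.mono fun k hk => by rw [hk, sub_self])
    refine h0.congr fun n => ?_
    simp only [AdaptiveIS.ξ, G, Finset.sum_sub_distrib, Finset.sum_const, Finset.card_range,
      nsmul_eq_mul]
    rcases n.eq_zero_or_pos with rfl | hn
    · simp
    -- `√n (1 / n) = 1 / √n`
    · have hn0 : (0 : ℝ) < n := by exact_mod_cast hn
      have hsq : √(n : ℝ) ^ 2 = n := Real.sq_sqrt hn0.le
      have : √(n : ℝ) ≠ 0 := (Real.sqrt_pos.mpr hn0).ne'
      field_simp
      rw [hsq]
      ring
  exact tendstoInDistribution_of_tendstoInMeasure_sub _ _ key (tendstoInMeasure_of_tendsto_ae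
    (fun n => ((hξ n).sub (key.forall_aemeasurable n)).aestronglyMeasurable) hae) hξ
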